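/- For positive integers $n,m$ and even $g$, a bipartite biregular $(n,m;g)$-graph is a finite simple bipartite graph of girth $g$ in which all vertices of one partite set have degree $n$ and all vertices of the other have degree $m$; an $(n,m;g)$-bipartite biregular cage is such a graph with the least possible number of vertices (its order). Put $n_0(3,m;6)=\left\lceil \frac{(m+3)(2m+1)}{3}\right\rceil$. A Steiner triple system $STS(v)$ is a set of 3-element subsets (blocks) of a $v$-element set of points such that every pair of points lies in exactly one block; its incidence graph has the points and the blocks as vertices, a point being adjacent to the blocks that contain it. Theorem 3.4. Let $m>3$ be an integer. 1. If $m\equiv 0,1 \pmod 3$, then an $STS(2m+1)$ exists, and the $(3,m;6)$-bipartite biregular cages are, up to isomorphism, exactly the incidence graphs of Steiner triple systems $STS(2m+1)$; their order is $n_0(3,m;6)$. 2. If $m\equiv 2\pmod 3$, then every $(3,m;6)$-bipartite biregular cage has order $$\frac{(m+3)(2m+1)}{3}+\frac{m+3}{3}=n_0(3,m;6)+\frac{m+1}{3}.$$ Moreover an $STS(2m+3)$ exists, and for every $STS(2m+3)$ and every point $x$ of it, deleting $x$ and all blocks through $x$ from the incidence graph gives a $(3,m;6)$-bipartite biregular cage.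 -/

import Mathlib

/-- `G` is a (finite, simple) bipartite biregular `(n, m; g)`-graph: `G` is bipartite with partite
sets `A` and `B`, all vertices of `A` have degree `n`, all vertices of `B` have degree `m`, and the
girth of `G` is `g`. Since `egirth` is finite, `G` has a cycle, so `A` and `B` are both nonempty and
the degree set is exactly `{n, m}`. -/
structure IsBipartiteBiregular {V : Type*} (G : SimpleGraph V) (n m g : ℕ) : Prop where
  finite : Finite V
  biregular : ∃ A B : Set V, A ∪ B = Set.univ ∧ G.IsBipartiteWith A B ∧
    (∀ v ∈ A, (G.neighborSet v).ncard = n) ∧ (∀ v ∈ B, (G.neighborSet v).ncard = m)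
  egirth_eq : G.egirth = (g : ℕ∞)

/-- An `(n, m; g)`-bipartite biregular cage: a bipartite biregular `(n, m; g)`-graph of minimum
order. Every finite graph is isomorphic to one on some `Fin k`, so it is enough to compare with the
graphs on these vertex sets. -/
structure IsBipartiteBiregularCage {V : Type*} (G : SimpleGraph V) (n m g : ℕ) : Prop where
  isBipartiteBiregular : IsBipartiteBiregular G n m g
  minimal : ∀ (k : ℕ) (H : SimpleGraph (Fin k)), IsBipartiteBiregular H n m g → Nat.card V ≤ k

/-- The lower bound `n₀(n, m; 6) = ⌈(m + n) (m n - m + 1) / n⌉`. -/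
def mooreBoundSix (n m : ℕ) : ℤ :=
  ⌈(((m : ℚ) + n) * ((m : ℚ) * n - m + 1)) / n⌉

/-- The set `ℬ` of blocks is a Steiner system `S(t, k, v)` on the point set `P`. -/
structure IsSteinerSystem {P : Type*} (t k v : ℕ) (ℬ : Set (Finset P)) : Prop where
  two_le : 2 ≤ t
  t_le_k : t ≤ k
  k_le_v : k ≤ v
  finite : Finite P
  card_points : Nat.card P = v
  card_block : ∀ b ∈ ℬ, b.card = k
  existsUnique_block : ∀ s : Finset P, s.card = t → ∃! b : Finset P, b ∈ ℬ ∧ s ⊆ b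

/-- A Steiner triple system `STS(v)` is a Steiner system `S(2, 3, v)`. -/
def IsSteinerTripleSystem {P : Type*} (v : ℕ) (ℬ : Set (Finset P)) : Prop :=
  IsSteinerSystem 2 3 v ℬ

/-- The point-block incidence graph: its vertices are the points and the blocks, and a point is
adjacent to exactly the blocks that contain it. -/
def incidenceGraph {P : Type*} (ℬ : Set (Finset P)) : SimpleGraph (P ⊕ ℬ) where
  Adj u w :=
    match u, w with
    | .inl p, .inr b => p ∈ b.1
    | .inr b, .inl p => p ∈ b.1
    | .inl _, .inl _ => False
    | .inr _, .inr _ => False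
  symm := ⟨by rintro (p | b) (q | c) h <;> exact h⟩
  loopless := ⟨by rintro (p | b) h <;> exact h⟩

/-- The incidence graph with the point `x` and all blocks through `x` deleted: the subgraph induced
on the complement of `{x} ∪ N(x)`. -/
def deletedIncidenceGraph {P : Type*} (ℬ : Set (Finset P)) (x : P) :
    SimpleGraph ↥(({Sum.inl x} ∪ (incidenceGraph ℬ).neighborSet (Sum.inl x))ᶜ : Set (P ⊕ ℬ)) :=
  (incidenceGraph ℬ).induce ({Sum.inl x} ∪ (incidenceGraph ℬ).neighborSet (Sum.inl x))ᶜ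

/-! Call the vertices of degree 3 blocks and those of degree `m` points. Girth 6 excludes 4-cycles,
so two points share at most one block and each point is collinear with exactly `2m` others
(`ncard_collinearSet`); hence there are at least `2m + 1` points. Counting edges gives `3|A| =
m|B|`, so `3|V| = (m + 3)|B|` and minimizing the order means minimizing the number of points.

With exactly `2m + 1` points any two are collinear, and the graph is the incidence graph of a
Steiner triple system. If `m ≡ 2 (mod 3)`, then `3 ∣ m|B|` forces `3 ∣ |B|`, so `|B| ≥ 2m + 2`; an
`STS(2m + 3)` with one point removed attains this.

Conversely, these graphs have girth exactly 6: bipartiteness and linearity give at least 6, and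
`egirth_eq_six` finds a triangle as soon as `|B| ≤ 2m + 2`. Existence of the triple systems comes
from the Bose and Skolem constructions, written as Steiner quasigroups: the third point of a block
as a function of the other two. -/

/-- A Steiner quasigroup: a commutative idempotent operation with `x * (x * y) = y`. -/
structure IsSteinerQuasigroup {P : Type*} (t : P → P → P) : Prop where
  comm : ∀ x y, t x y = t y x
  idem : ∀ x, t x x = x
  cancel : ∀ x y, t x (t x y) = y

namespace IsSteinerQuasigroup

variable {P Q : Type*} {t : P → P → P}

lemma ne_left (h : IsSteinerQuasigroup t) {x y : P} (hxy : x ≠ y) : t x y ≠ x := by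
  intro e
  have := h.cancel x y
  rw [e, h.idem] at this
  exact hxy this

lemma ne_right (h : IsSteinerQuasigroup t) {x y : P} (hxy : x ≠ y) : t x y ≠ y := by
  rw [h.comm]
  exact h.ne_left hxy.symm

lemma cancel_right (h : IsSteinerQuasigroup t) (x y : P) : t (t x y) y = x := by
  rw [h.comm, h.comm x y, h.cancel]

lemma cancel_left (h : IsSteinerQuasigroup t) (x y : P) : t (t x y) x = y := by
  rw [h.comm, h.cancel]

lemma cancel_right' (h : IsSteinerQuasigroup t) (x y : P) : t y (t x y) = x := by
  rw [h.comm x y, h.cancel]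

lemma transport (h : IsSteinerQuasigroup t) (e : P ≃ Q) :
    IsSteinerQuasigroup fun x y => e (t (e.symm x) (e.symm y)) where
  comm x y := by rw [h.comm]
  idem x := by simp [h.idem]
  cancel x y := by simp [h.cancel]

/-- The triples `{x, y, x * y}` of a finite Steiner quasigroup form a Steiner triple system. -/
lemma isSteinerTripleSystem [DecidableEq P] [Finite P] (h : IsSteinerQuasigroup t) {v : ℕ}
    (hv : Nat.card P = v) (h3 : 3 ≤ v) :
    IsSteinerTripleSystem v {b : Finset P | ∃ x y, x ≠ y ∧ b = {x, y, t x y}} where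
  two_le := le_rfl
  t_le_k := by norm_num
  k_le_v := h3
  finite := inferInstance
  card_points := hv
  card_block := by
    rintro b ⟨x, y, hxy, rfl⟩
    exact Finset.card_eq_three.2
      ⟨x, y, t x y, hxy, (h.ne_left hxy).symm, (h.ne_right hxy).symm, rfl⟩
  existsUnique_block := by
    intro s hs
    obtain ⟨a, b, hab, rfl⟩ := Finset.card_eq_two.1 hs
    refine ⟨{a, b, t a b}, ⟨⟨a, b, hab, rfl⟩, ?_⟩, ?_⟩
    · intro z
      simp only [Finset.mem_insert, Finset.mem_singleton]
      tauto
    · rintro _ ⟨⟨x, y, hxy, rfl⟩, hsub⟩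
      have ha : a ∈ ({x, y, t x y} : Finset P) := hsub (by simp)
      have hb : b ∈ ({x, y, t x y} : Finset P) := hsub (by simp)
      simp only [Finset.mem_insert, Finset.mem_singleton] at ha hb
      rcases ha with rfl | rfl | rfl <;> rcases hb with rfl | rfl | rfl <;>
        first
        | exact absurd rfl hab
        | rfl
        | (rw [h.comm, Finset.insert_comm]; done)
        | (ext z
           simp [h.cancel, h.cancel_left, h.cancel_right, h.cancel_right']
           try tauto)

lemma exists_isSteinerTripleSystem_fin [Finite P] (h : IsSteinerQuasigroup t) {v : ℕ}
    (hv : Nat.card P = v) (h3 : 3 ≤ v) :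
    ∃ ℬ : Set (Finset (Fin v)), IsSteinerTripleSystem v ℬ :=
  ⟨_, (h.transport (Finite.equivFinOfCardEq hv)).isSteinerTripleSystem (by simp) h3⟩

end IsSteinerQuasigroup

/-! ### The Bose and Skolem constructions -/

section Constructions

variable {Q : Type*} [DecidableEq Q]

/-- Bose's construction, from an idempotent commutative quasigroup `op` with division `dv`. -/
def boseOp (op dv : Q → Q → Q) (x y : Q × ZMod 3) : Q × ZMod 3 :=
  if x.2 = y.2 then (if x.1 = y.1 then x else (op x.1 y.1, x.2 + 1))
  else if y.2 = x.2 + 1 then (if x.1 = y.1 then (x.1, x.2 + 2) else (dv x.1 y.1, x.2))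
  else (if x.1 = y.1 then (x.1, x.2 + 1) else (dv y.1 x.1, y.2))

/-- The blocks behind the operation are `{(a, 0), (a, 1), (a, 2)}` and, for `a ≠ b`, `{(a, i), (b,
i), (op a b, i + 1)}`; `dv` recovers the third point when the two given ones lie on different
levels. -/
lemma isSteinerQuasigroup_boseOp {op dv : Q → Q → Q} (comm : ∀ a b, op a b = op b a)
    (idem : ∀ a, op a a = a) (op_dv : ∀ a c, op a (dv a c) = c) (dv_op : ∀ a b, dv a (op a b) = b) :
    IsSteinerQuasigroup (boseOp op dv) := by
  have dv_eq : ∀ a c, a = dv a c ↔ a = c := fun a c =>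
    ⟨fun h => by rw [← op_dv a c, ← h, idem], fun h => by rw [← h]; nth_rw 3 [← idem a]; rw [dv_op]⟩
  have op_eq : ∀ a b, a = op a b ↔ a = b := fun a b =>
    ⟨fun h => by rw [← dv_op a b, ← h]; exact (dv_eq a a).2 rfl, fun h => by rw [← h, idem]⟩
  have dv_dv : ∀ a b, dv (dv b a) a = b := fun a b => by
    nth_rw 2 [← op_dv b a]
    rw [comm, dv_op]
  have eq_dv : ∀ a b, a = dv b a ↔ a = b := fun a b =>
    ⟨fun h => by rw [← dv_dv a b, ← h]; exact (dv_eq a a).2 rfl,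
      fun h => by rw [← h]; exact (dv_eq a a).2 rfl⟩
  have h3 : ∀ i j : ZMod 3, j = i ∨ j = i + 1 ∨ j = i + 2 := by decide
  have hs : ∀ i : ZMod 3, i + 1 ≠ i ∧ i + 2 ≠ i ∧ i ≠ i + 1 ∧ i ≠ i + 2 ∧ i + 1 ≠ i + 2 ∧
      i + 2 ≠ i + 1 ∧ i + 1 + 1 = i + 2 ∧ i + 2 + 1 = i ∧ i + 1 + 2 = i ∧ i + 2 + 2 = i + 1 := by
    decide
  refine ⟨?_, ?_, ?_⟩
  · rintro ⟨a, i⟩ ⟨b, j⟩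
    rcases eq_or_ne a b with rfl | hab
    · rcases h3 i j with rfl | rfl | rfl <;> simp [boseOp, hs]
    rcases h3 i j with rfl | rfl | rfl
    all_goals simp [boseOp, hs, hab, hab.symm, comm a]
  · rintro ⟨a, i⟩
    simp [boseOp]
  · rintro ⟨a, i⟩ ⟨b, j⟩
    rcases eq_or_ne a b with rfl | hab <;> rcases h3 i j with rfl | rfl | rfl
    all_goals simp [boseOp, *]

/-- Skolem's construction, from a half-idempotent commutative quasigroup `op` with division `dv`,
where `s` exchanges the idempotent elements with the others. -/
def skolemOp (op dv : Q → Q → Q) (s : Q → Q) (I : Q → Prop) [DecidablePred I] :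
    Option (Q × ZMod 3) → Option (Q × ZMod 3) → Option (Q × ZMod 3)
  | none, none => none
  | none, some (a, i) => some (s a, if I a then i + 2 else i + 1)
  | some (a, i), none => some (s a, if I a then i + 2 else i + 1)
  | some (a, i), some (b, j) =>
    if i = j then (if a = b then some (a, i) else some (op a b, i + 1))
    else if j = i + 1 then
      (if op a a = b then (if I a then some (a, i + 2) else none) else some (dv a b, i))
    else (if op b b = a then (if I b then some (b, i + 1) else none) else some (dv b a, j))

/-- With `none` as the point at infinity, the blocks are `{(a, 0), (a, 1), (a, 2)}` for `I a`, `{∞,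
(a, i), (s a, i + 1)}` for `¬ I a`, and `{(a, i), (b, i), (op a b, i + 1)}` for `a ≠ b`. -/
lemma isSteinerQuasigroup_skolemOp {op dv : Q → Q → Q} {s : Q → Q} {I : Q → Prop} [DecidablePred I]
    (comm : ∀ a b, op a b = op b a) (op_dv : ∀ a c, op a (dv a c) = c)
    (dv_op : ∀ a b, dv a (op a b) = b) (s_s : ∀ a, s (s a) = a) (I_s : ∀ a, I (s a) ↔ ¬ I a)
    (op_self : ∀ a, op a a = if I a then a else s a) :
    IsSteinerQuasigroup (skolemOp op dv s I) := by
  have op_inj : ∀ a b c, op a b = op a c ↔ b = c := fun a b c =>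
    ⟨fun h => by rw [← dv_op a b, h, dv_op], fun h => by rw [h]⟩
  have dv_dv : ∀ a b, dv (dv b a) a = b := fun a b => by
    nth_rw 2 [← op_dv b a]
    rw [comm, dv_op]
  have dv_eq : ∀ a b, a = dv a b ↔ op a a = b := fun a b => by
    rw [← op_inj a a, op_dv]
  have op_dv_dv : ∀ a b, op (dv b a) (dv b a) = a ↔ op b b = a := fun a b => by
    nth_rw 3 [← op_dv b a]
    rw [comm b, op_inj, eq_comm, dv_eq]
  have h3 : ∀ i j : ZMod 3, j = i ∨ j = i + 1 ∨ j = i + 2 := by decide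
  have hs : ∀ i : ZMod 3, i + 1 ≠ i ∧ i + 2 ≠ i ∧ i ≠ i + 1 ∧ i ≠ i + 2 ∧ i + 1 ≠ i + 2 ∧
      i + 2 ≠ i + 1 ∧ i + 1 + 1 = i + 2 ∧ i + 2 + 1 = i ∧ i + 1 + 2 = i ∧ i + 2 + 2 = i + 1 := by
    decide
  refine ⟨?_, ?_, ?_⟩
  · rintro (_ | ⟨a, i⟩) (_ | ⟨b, j⟩)
    · rfl
    · rfl
    · rfl
    · rcases h3 i j with rfl | rfl | rfl
      · rcases eq_or_ne a b with rfl | hab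
        · rfl
        · simp [skolemOp, hab, hab.symm, comm a]
      all_goals simp [skolemOp, hs]
  · rintro (_ | ⟨a, i⟩) <;> simp [skolemOp]
  · rintro (_ | ⟨a, i⟩) (_ | ⟨b, j⟩)
    · rfl
    · by_cases hb : I b <;> simp [skolemOp, hb, hs, s_s, I_s]
    · by_cases ha : I a <;> simp [skolemOp, ha, hs, s_s, I_s, op_self]
    · rcases h3 i j with rfl | rfl | rfl
      · rcases eq_or_ne a b with rfl | hab
        · simp [skolemOp]
        · simp [skolemOp, hab, hs, op_inj, dv_op]
      · by_cases hab : op a a = b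
        · subst hab
          by_cases ha : I a <;> simp [skolemOp, hs, ha, op_self]
        · simp [skolemOp, hs, hab, dv_eq, op_dv]
      · by_cases hab : op b b = a
        · subst hab
          by_cases hb : I b <;> simp [skolemOp, hs, hb, op_self, I_s, s_s]
        · simp [skolemOp, hs, hab, op_dv_dv, dv_dv]

end Constructions

theorem exists_isSteinerTripleSystem_six_mul_add_three (k : ℕ) :
    ∃ ℬ : Set (Finset (Fin (6 * k + 3))), IsSteinerTripleSystem (6 * k + 3) ℬ := by
  -- `k + 1` is the inverse of 2, so the quasigroup used below is the average of `a` and `b`.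
  have hk : ((k : ZMod (2 * k + 1)) + 1) * 2 = 1 := by
    have : ((2 * k + 1 : ℕ) : ZMod (2 * k + 1)) = 0 := ZMod.natCast_self _
    push_cast at this
    linear_combination this
  have h := isSteinerQuasigroup_boseOp (Q := ZMod (2 * k + 1))
    (op := fun a b => ((k : ZMod (2 * k + 1)) + 1) * (a + b)) (dv := fun a c => 2 * c - a)
    (fun a b => by ring) (fun a => by linear_combination a * hk)
    (fun a c => by linear_combination c * hk) (fun a b => by linear_combination (a + b) * hk)
  refine h.exists_isSteinerTripleSystem_fin ?_ (by omega)
  simp only [Nat.card_prod, Nat.card_zmod]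
  ring

theorem exists_isSteinerTripleSystem_six_mul_add_one {k : ℕ} (hk : 0 < k) :
    ∃ ℬ : Set (Finset (Fin (6 * k + 1))), IsSteinerTripleSystem (6 * k + 1) ℬ := by
  -- The quasigroup is addition modulo `2k` (reduced by `r`) relabelled by `h`, which sends `2j` to
  -- `j` and `2j + 1` to `k + j`; `d` inverts `h`. Thus `a + a` becomes `a` for `a < k` and `a - k`
  -- otherwise, which makes it half-idempotent.
  let r (x : ℕ) : ℕ := if x < 2 * k then x else x - 2 * k
  let h (x : ℕ) : ℕ := if x % 2 = 0 then x / 2 else k + x / 2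
  let d (x : ℕ) : ℕ := if x < k then 2 * x else 2 * (x - k) + 1
  have hr : ∀ x, x < 4 * k → r x < 2 * k := fun x hx => by simp only [r]; split_ifs <;> omega
  have hh : ∀ x, x < 2 * k → h x < 2 * k := fun x hx => by simp only [h]; split_ifs <;> omega
  have h1 := isSteinerQuasigroup_skolemOp (Q := Fin (2 * k))
    (op := fun a b => ⟨h (r (a + b)), hh _ (hr _ (by omega))⟩)
    (dv := fun a c => ⟨r (d c + 2 * k - a), hr _ (by simp only [d]; split_ifs <;> omega)⟩)
    (s := fun a => ⟨r (a + k), hr _ (by omega)⟩) (I := fun a => (a : ℕ) < k)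
    (fun a b => by simp only [Nat.add_comm (a : ℕ)])
    (fun ⟨a, ha⟩ ⟨c, hc⟩ => by
      simp only [Fin.mk.injEq, r, h, d]
      split_ifs <;> omega)
    (fun ⟨a, ha⟩ ⟨b, hb⟩ => by
      simp only [Fin.mk.injEq, r, h, d]
      split_ifs <;> omega)
    (fun ⟨a, ha⟩ => by
      simp only [Fin.mk.injEq, r]
      split_ifs <;> omega)
    (fun ⟨a, ha⟩ => by
      simp only [r]
      split_ifs <;> omega)
    (fun ⟨a, ha⟩ => by
      refine Fin.ext ?_
      simp only [r, h, apply_ite Fin.val]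
      split_ifs <;> omega)
  refine h1.exists_isSteinerTripleSystem_fin ?_ (by omega)
  rw [Finite.card_option]
  simp only [Nat.card_prod, Nat.card_zmod, Nat.card_fin]
  ring

/-! ### Partial triple systems: counting and girth -/

/-- `A` and `B` are the blocks and the points of a partial triple system with incidence graph `G`:
blocks have three points and two points lie on at most one common block. -/
structure IsPartialTripleGraph {V : Type*} (G : SimpleGraph V) (A B : Set V) : Prop where
  union_eq : A ∪ B = Set.univ
  bipartite : G.IsBipartiteWith A B
  ncard_block : ∀ a ∈ A, (G.neighborSet a).ncard = 3
  linear : ∀ ⦃p q a b : V⦄, p ∈ B → p ≠ q → G.Adj p a → G.Adj q a → G.Adj p b → G.Adj q b → a = b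

/-- The points other than `p` that have a common block with `p`. -/
def collinearSet {V : Type*} (G : SimpleGraph V) (p : V) : Set V :=
  {q | q ≠ p ∧ ∃ a, G.Adj p a ∧ G.Adj a q}

lemma SimpleGraph.card_neighborFinset_eq_ncard {V : Type*} (G : SimpleGraph V) (v : V)
    [Fintype (G.neighborSet v)] : (G.neighborFinset v).card = (G.neighborSet v).ncard := by
  rw [← Set.ncard_coe_finset, G.coe_neighborFinset]

namespace IsPartialTripleGraph

variable {V : Type*} {G : SimpleGraph V} {A B : Set V}

lemma mem_or (h : IsPartialTripleGraph G A B) (v : V) : v ∈ A ∨ v ∈ B := by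
  have : v ∈ A ∪ B := h.union_eq ▸ Set.mem_univ v
  exact this

lemma mem_block (h : IsPartialTripleGraph G A B) {p a : V} (hp : p ∈ B) (hpa : G.Adj p a) :
    a ∈ A :=
  h.bipartite.symm.mem_of_mem_adj hp hpa

lemma mem_point (h : IsPartialTripleGraph G A B) {p a : V} (ha : a ∈ A) (hap : G.Adj a p) :
    p ∈ B :=
  h.bipartite.mem_of_mem_adj ha hap

/-- Absence of 4-cycles is self-dual: if `u`, `v` are blocks, `linear` applies to the points `a`,
`b` instead. -/
lemma eq_of_adj (h : IsPartialTripleGraph G A B) {u v a b : V} (huv : u ≠ v) (hua : G.Adj u a)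
    (hva : G.Adj v a) (hub : G.Adj u b) (hvb : G.Adj v b) : a = b := by
  by_contra hab
  rcases h.mem_or u with hu | hu
  · exact huv (h.linear (h.mem_point hu hua) hab hua.symm hub.symm hva.symm hvb.symm)
  · exact hab (h.linear hu huv hua hva hub hvb)

/-- Each block through `p` contributes two further points, and linearity makes these pairs disjoint.
-/
lemma ncard_collinearSet [Finite V] (h : IsPartialTripleGraph G A B) {p : V} (hp : p ∈ B) :
    (collinearSet G p).ncard = 2 * (G.neighborSet p).ncard := by
  classical
  have := Fintype.ofFinite V
  have hset : collinearSet G p =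
      ((G.neighborFinset p).biUnion fun a => (G.neighborFinset a).erase p : Finset V) := by
    ext q
    simp [collinearSet]
    tauto
  rw [hset, Set.ncard_coe_finset, Finset.card_biUnion]
  · rw [Finset.sum_const_nat (m := 2), mul_comm, G.card_neighborFinset_eq_ncard]
    intro a ha
    have hpa : G.Adj p a := by simpa using ha
    have h3 := h.ncard_block a (h.mem_block hp hpa)
    rw [← G.card_neighborFinset_eq_ncard] at h3
    rw [Finset.card_erase_of_mem (by simpa using hpa.symm), h3]
  · intro a ha b hb hab
    rw [Function.onFun, Finset.disjoint_left]
    intro q hqa hqb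
    simp only [SimpleGraph.coe_neighborFinset, SimpleGraph.mem_neighborSet,
      SimpleGraph.mem_neighborFinset, Finset.mem_erase] at ha hb hqa hqb
    exact hab (h.eq_of_adj hqa.1.symm ha hqa.2.symm hb hqb.2.symm)

lemma collinearSet_subset (h : IsPartialTripleGraph G A B) {p : V} (hp : p ∈ B) :
    collinearSet G p ⊆ B \ {p} := by
  rintro q ⟨hqp, a, hpa, haq⟩
  exact ⟨h.mem_point (h.mem_block hp hpa) haq, hqp⟩

lemma two_mul_ncard_lt [Finite V] (h : IsPartialTripleGraph G A B) {p : V} (hp : p ∈ B) :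
    2 * (G.neighborSet p).ncard + 1 ≤ B.ncard := by
  rw [← h.ncard_collinearSet hp, ← Set.ncard_sdiff_singleton_add_one hp]
  exact Nat.add_le_add_right (Set.ncard_le_ncard (h.collinearSet_subset hp)) 1

/-- Double counting of the edges. -/
lemma three_mul_ncard [Finite V] (h : IsPartialTripleGraph G A B) {m : ℕ}
    (hB : ∀ p ∈ B, (G.neighborSet p).ncard = m) : 3 * A.ncard = m * B.ncard := by
  classical
  have := Fintype.ofFinite V
  have hbip : G.IsBipartiteWith (A.toFinset : Set V) (B.toFinset : Set V) := by
    simpa using h.bipartite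
  have key := SimpleGraph.isBipartiteWith_sum_degrees_eq hbip
  have hd : ∀ v, G.degree v = (G.neighborSet v).ncard := fun v => by
    rw [← G.card_neighborFinset_eq_degree, G.card_neighborFinset_eq_ncard]
  rw [Finset.sum_const_nat (m := 3) fun v hv => by rw [hd, h.ncard_block v (by simpa using hv)],
    Finset.sum_const_nat (m := m) fun v hv => by rw [hd, hB v (by simpa using hv)],
    ← Set.ncard_eq_toFinset_card', ← Set.ncard_eq_toFinset_card'] at key
  linarith

lemma ncard_add_ncard [Finite V] (h : IsPartialTripleGraph G A B) :
    A.ncard + B.ncard = Nat.card V := by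
  rw [← Set.ncard_union_eq h.bipartite.disjoint, h.union_eq, Set.ncard_univ]

lemma three_mul_card [Finite V] (h : IsPartialTripleGraph G A B) {m : ℕ}
    (hB : ∀ p ∈ B, (G.neighborSet p).ncard = m) : 3 * Nat.card V = (m + 3) * B.ncard := by
  rw [← h.ncard_add_ncard, mul_add, h.three_mul_ncard hB]
  ring

lemma six_le_egirth (h : IsPartialTripleGraph G A B) : 6 ≤ G.egirth := by
  rw [SimpleGraph.le_egirth]
  intro u w hw
  have h3 := hw.three_le_length
  have he := SimpleGraph.two_colorable_iff_forall_loop_even.1 h.bipartite.isBipartite u w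
  have h4 : w.length ≠ 4 := by
    intro h4
    match w, hw, h4 with
    | .cons hab (.cons hbc (.cons hcd (.cons hda .nil))), hw, _ =>
      simp only [SimpleGraph.Walk.cons_isCycle_iff, SimpleGraph.Walk.isPath_def,
        SimpleGraph.Walk.support_cons, SimpleGraph.Walk.support_nil, List.nodup_cons,
        List.mem_cons, not_or] at hw
      exact hw.1.1.2.1 (h.eq_of_adj (by tauto) hab hbc.symm hda.symm hcd)
  have : 6 ≤ w.length := by
    obtain ⟨k, hk⟩ := he
    omega
  exact_mod_cast this

lemma egirth_eq_six_of_hexagon (h : IsPartialTripleGraph G A B) {p q r a b c : V} (hp : p ∈ B)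
    (hpq : p ≠ q) (hqr : q ≠ r) (hpr : p ≠ r) (hab : a ≠ b) (hbc : b ≠ c) (hac : a ≠ c)
    (hpa : G.Adj p a) (haq : G.Adj a q) (hqb : G.Adj q b) (hbr : G.Adj b r) (hrc : G.Adj r c)
    (hcp : G.Adj c p) : G.egirth = 6 := by
  have ha := h.mem_block hp hpa
  have hq := h.mem_point ha haq
  have hb := h.mem_block hq hqb
  have hr := h.mem_point hb hbr
  have hc := h.mem_block hr hrc
  have hne : ∀ {x y : V}, x ∈ A → y ∈ B → x ≠ y := fun hx hy e =>
    Set.disjoint_left.1 h.bipartite.disjoint hx (e ▸ hy)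
  refine le_antisymm ?_ h.six_le_egirth
  let w : G.Walk p p := .cons hpa (.cons haq (.cons hqb (.cons hbr (.cons hrc (.cons hcp .nil)))))
  have hw : w.IsCycle := by
    simp only [w, SimpleGraph.Walk.cons_isCycle_iff, SimpleGraph.Walk.isPath_def]
    simp [hpq, hpq.symm, hqr, hpr.symm, hab, hbc, hac, hne ha hp, hne ha hq, hne ha hr,
      (hne hb hq).symm, hne hb hr, hne hb hp, (hne hc hr).symm, hne hc hp, (hne hc hq).symm,
      (hne ha hp).symm, (hne hb hp).symm, (hne hc hp).symm, hpr]
  exact SimpleGraph.egirth_le_length hw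

/-- A partial triple system in which every point is collinear with all but at most one of the other
points contains a triangle. -/
lemma egirth_eq_six [Finite V] (h : IsPartialTripleGraph G A B) {m : ℕ} (hm : 2 ≤ m)
    (hB : ∀ p ∈ B, (G.neighborSet p).ncard = m) (hne : B.Nonempty) (hcard : B.ncard ≤ 2 * m + 2) :
    G.egirth = 6 := by
  obtain ⟨p, hp⟩ := hne
  obtain ⟨a, ha, b, hb, hab⟩ := (Set.one_lt_ncard (s := G.neighborSet p)).1 (by rw [hB p hp]; omega)
  rw [SimpleGraph.mem_neighborSet] at ha hb
  have others : ∀ a, G.Adj p a → ∃ x y, x ≠ p ∧ y ≠ p ∧ x ≠ y ∧ G.Adj a x ∧ G.Adj a y := by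
    intro a ha
    obtain ⟨x, y, z, hxy, hxz, hyz, hN⟩ :=
      Set.ncard_eq_three.1 (h.ncard_block a (h.mem_block hp ha))
    have hx : G.Adj a x := by rw [← SimpleGraph.mem_neighborSet, hN]; simp
    have hy : G.Adj a y := by rw [← SimpleGraph.mem_neighborSet, hN]; simp
    have hz : G.Adj a z := by rw [← SimpleGraph.mem_neighborSet, hN]; simp
    by_cases h1 : x = p
    · exact ⟨y, z, h1 ▸ hxy.symm, h1 ▸ hxz.symm, hyz, hy, hz⟩
    by_cases h2 : y = p
    · exact ⟨x, z, h1, h2 ▸ hyz.symm, hxz, hx, hz⟩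
    · exact ⟨x, y, h1, h2, hxy, hx, hy⟩
  obtain ⟨x, -, hxp, -, -, hax, -⟩ := others a ha
  obtain ⟨y, z, hyp, hzp, hyz, hby, hbz⟩ := others b hb
  have hA := h.mem_block hp ha
  have hx := h.mem_point hA hax
  have hb' := h.mem_block hp hb
  -- If `x` on `a` is collinear with `y` on `b`, then `p`, `x`, `y` form a triangle, that is, a
  -- 6-cycle.
  have key : ∀ y, y ≠ p → G.Adj b y → y ∈ collinearSet G x → G.egirth = 6 := by
    rintro y hyp hby ⟨hyx, c, hxc, hcy⟩
    refine h.egirth_eq_six_of_hexagon (a := a) (b := c) (c := b) (q := x) (r := y) hp hxp.symm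
      hyx.symm hyp.symm ?_ ?_ hab ha hax hxc hcy hby.symm hb.symm
    · rintro rfl
      exact hab (h.eq_of_adj hyp.symm ha hcy.symm hb hby.symm)
    · rintro rfl
      exact hab (h.eq_of_adj hxp.symm ha hax.symm hb hxc)
  have hxb : ¬ G.Adj b x := fun hbx => hab (h.eq_of_adj hxp.symm ha hax.symm hb hbx.symm)
  by_contra hcon
  -- Without a triangle, the `2m` points collinear with `x` would lie in a set of at most `2m + 2 -
  -- 3` points.
  have hsub : collinearSet G x ⊆ B \ {x, y, z} := by
    intro q hq
    refine ⟨(h.collinearSet_subset hx hq).1, ?_⟩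
    rintro (rfl | rfl | rfl)
    · exact hq.1 rfl
    · exact hcon (key _ hyp hby hq)
    · exact hcon (key _ hzp hbz hq)
  have h1 := Set.ncard_le_ncard hsub
  rw [h.ncard_collinearSet hx, hB x hx, Set.ncard_sdiff, Set.ncard_eq_three.2 ⟨x, y, z, ?_, ?_, hyz, rfl⟩] at h1
  · omega
  · rintro rfl
    exact hxb hby
  · rintro rfl
    exact hxb hbz
  · rintro q (rfl | rfl | rfl)
    · exact hx
    · exact h.mem_point hb' hby
    · exact h.mem_point hb' hbz

lemma isBipartiteBiregular [Finite V] (h : IsPartialTripleGraph G A B) {m : ℕ} (hm : 2 ≤ m)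
    (hB : ∀ p ∈ B, (G.neighborSet p).ncard = m) (hne : B.Nonempty) (hcard : B.ncard ≤ 2 * m + 2) :
    IsBipartiteBiregular G 3 m 6 :=
  ⟨inferInstance, ⟨A, B, h.union_eq, h.bipartite, h.ncard_block, hB⟩,
    h.egirth_eq_six hm hB hne hcard⟩

end IsPartialTripleGraph

/-! ### Lower bounds for the order -/

namespace IsBipartiteBiregular

variable {V : Type*} {G : SimpleGraph V} {m : ℕ}

lemma exists_isPartialTripleGraph (h : IsBipartiteBiregular G 3 m 6) :
    ∃ A B : Set V, IsPartialTripleGraph G A B ∧ (∀ p ∈ B, (G.neighborSet p).ncard = m) ∧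
      B.Nonempty := by
  obtain ⟨A, B, hAB, hbip, hA, hB⟩ := h.biregular
  refine ⟨A, B, ⟨hAB, hbip, hA, ?_⟩, hB, ?_⟩
  · intro p q a b hp hpq hpa hqa hpb hqb
    by_contra hab
    let w : G.Walk p p := .cons hpa (.cons hqa.symm (.cons hqb (.cons hpb.symm .nil)))
    have hw : w.IsCycle := by
      simp only [w, SimpleGraph.Walk.cons_isCycle_iff, SimpleGraph.Walk.isPath_def]
      simp [hpq, hpq.symm, hab, hpa.ne, hpa.ne', hqa.ne', hpb.ne', hpb.ne, hqb.ne]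
    have := SimpleGraph.egirth_le_length hw
    rw [h.egirth_eq] at this
    simp [w] at this
    exact absurd this (by norm_num)
  · have hnac : ¬ G.IsAcyclic := by
      rw [← SimpleGraph.egirth_eq_top, h.egirth_eq]
      exact ENat.natCast_ne_top 6
    obtain ⟨v, -⟩ := SimpleGraph.exists_egirth_eq_length.2 hnac
    have hv : v ∈ A ∪ B := hAB ▸ Set.mem_univ v
    rcases hv with hv | hv
    · obtain ⟨p, hp⟩ := Set.nonempty_of_ncard_ne_zero (s := G.neighborSet v) (by rw [hA v hv]; norm_num)
      exact ⟨p, hbip.mem_of_mem_adj hv hp⟩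
    · exact ⟨v, hv⟩

lemma lower_bound (h : IsBipartiteBiregular G 3 m 6) :
    (m + 3) * (2 * m + 1) ≤ 3 * Nat.card V := by
  have := h.finite
  obtain ⟨A, B, hG, hB, p, hp⟩ := h.exists_isPartialTripleGraph
  rw [hG.three_mul_card hB]
  refine Nat.mul_le_mul_left _ ?_
  simpa [hB p hp] using hG.two_mul_ncard_lt hp

lemma lower_bound_of_mod_three (h : IsBipartiteBiregular G 3 m 6) (hm : m % 3 = 2) :
    (m + 3) * (2 * m + 2) ≤ 3 * Nat.card V := by
  have := h.finite
  obtain ⟨A, B, hG, hB, p, hp⟩ := h.exists_isPartialTripleGraph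
  rw [hG.three_mul_card hB]
  refine Nat.mul_le_mul_left _ ?_
  have h1 : 2 * m + 1 ≤ B.ncard := by simpa [hB p hp] using hG.two_mul_ncard_lt hp
  have h2 : 3 ∣ m * B.ncard := ⟨_, (hG.three_mul_ncard hB).symm⟩
  -- Since `3 ∤ m`, 3 divides `|B|`, whereas `2m + 1 ≡ 2 (mod 3)`.
  rcases (Nat.Prime.dvd_mul Nat.prime_three).1 h2 with h3 | h3 <;> omega

lemma of_iso {W : Type*} {H : SimpleGraph W} {n g : ℕ} (h : IsBipartiteBiregular G n m g)
    (e : G ≃g H) : IsBipartiteBiregular H n m g := by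
  obtain ⟨A, B, hAB, hbip, hA, hB⟩ := h.biregular
  have hN : ∀ w, (H.neighborSet w).ncard = (G.neighborSet (e.symm w)).ncard := by
    intro w
    rw [← Set.ncard_image_of_injective _ e.symm.injective]
    congr 1
    ext v
    simp only [Set.mem_image, SimpleGraph.mem_neighborSet]
    constructor
    · rintro ⟨u, hu, rfl⟩
      exact e.symm.map_adj_iff.2 hu
    · intro hv
      exact ⟨e v, by simpa using e.map_adj_iff.2 hv, by simp⟩
  refine ⟨?_, ⟨e.symm ⁻¹' A, e.symm ⁻¹' B, ?_, ⟨?_, ?_⟩, ?_, ?_⟩, ?_⟩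
  · have := h.finite
    exact Finite.of_equiv V e.toEquiv
  · rw [← Set.preimage_union, hAB, Set.preimage_univ]
  · exact hbip.disjoint.preimage _
  · intro v w hvw
    exact hbip.mem_of_adj (e.symm.map_adj_iff.2 hvw)
  · intro w hw
    rw [hN, hA _ hw]
  · intro w hw
    rw [hN, hB _ hw]
  · rw [← e.egirth_eq, h.egirth_eq]

end IsBipartiteBiregular

/-- Extends minimality from graphs on `Fin k` to all vertex types, in any universe. -/
lemma IsBipartiteBiregularCage.card_le {V W : Type*} {G : SimpleGraph V} {H : SimpleGraph W}
    {n m g : ℕ} (hG : IsBipartiteBiregularCage G n m g) (hH : IsBipartiteBiregular H n m g) :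
    Nat.card V ≤ Nat.card W := by
  have := hH.finite
  have := Fintype.ofFinite W
  exact hG.minimal _ _ (hH.of_iso (H.overFinIso Nat.card_eq_fintype_card.symm))

/-! ### Incidence graphs of triple systems, whole and with a point deleted -/

namespace IsSteinerSystem

variable {P : Type*} {v : ℕ} {ℬ : Set (Finset P)}

lemma exists_block (h : IsSteinerSystem 2 3 v ℬ) {x y : P} (hxy : x ≠ y) :
    ∃ b ∈ ℬ, x ∈ b ∧ y ∈ b := by
  classical
  obtain ⟨b, ⟨hb, hs⟩, -⟩ := h.existsUnique_block {x, y} (Finset.card_pair hxy)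
  exact ⟨b, hb, hs (by simp), hs (by simp)⟩

lemma block_eq (h : IsSteinerSystem 2 3 v ℬ) {x y : P} (hxy : x ≠ y) {b c : Finset P}
    (hb : b ∈ ℬ) (hc : c ∈ ℬ) (hxb : x ∈ b) (hyb : y ∈ b) (hxc : x ∈ c) (hyc : y ∈ c) : b = c := by
  classical
  refine (h.existsUnique_block {x, y} (Finset.card_pair hxy)).unique ⟨hb, ?_⟩ ⟨hc, ?_⟩
  · simp [Finset.insert_subset_iff, *]
  · simp [Finset.insert_subset_iff, *]

lemma finite_vertices (h : IsSteinerSystem 2 3 v ℬ) : Finite (P ⊕ ℬ) := by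
  have := h.finite
  infer_instance

end IsSteinerSystem

section

variable {P : Type*} {ℬ : Set (Finset P)}

@[simp]
lemma incidenceGraph_adj_inl_inr {p : P} {b : ℬ} :
    (incidenceGraph ℬ).Adj (.inl p) (.inr b) ↔ p ∈ b.1 := Iff.rfl

@[simp]
lemma incidenceGraph_adj_inr_inl {p : P} {b : ℬ} :
    (incidenceGraph ℬ).Adj (.inr b) (.inl p) ↔ p ∈ b.1 := Iff.rfl

@[simp]
lemma not_incidenceGraph_adj_inl_inl {p q : P} :
    ¬ (incidenceGraph ℬ).Adj (.inl p) (.inl q) := id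

@[simp]
lemma not_incidenceGraph_adj_inr_inr {b c : ℬ} :
    ¬ (incidenceGraph ℬ).Adj (.inr b) (.inr c) := id

lemma neighborSet_incidenceGraph_inr (b : ℬ) :
    (incidenceGraph ℬ).neighborSet (.inr b) = Sum.inl '' (b.1 : Set P) := by
  ext (p | c) <;> simp

lemma incidenceGraph_isBipartiteWith :
    (incidenceGraph ℬ).IsBipartiteWith (Set.range Sum.inr) (Set.range Sum.inl) where
  disjoint := Set.isCompl_range_inl_range_inr.symm.disjoint
  mem_of_adj := by
    rintro (p | b) (q | c) hpq <;> simp_all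

lemma IsSteinerTripleSystem.isPartialTripleGraph {v : ℕ} (h : IsSteinerTripleSystem v ℬ) :
    IsPartialTripleGraph (incidenceGraph ℬ) (Set.range Sum.inr) (Set.range Sum.inl) where
  union_eq := by rw [Set.union_comm, Set.range_inl_union_range_inr]
  bipartite := incidenceGraph_isBipartiteWith
  ncard_block := by
    rintro _ ⟨b, rfl⟩
    rw [neighborSet_incidenceGraph_inr, Set.ncard_image_of_injective _ Sum.inl_injective,
      Set.ncard_coe_finset, h.card_block b b.2]
  linear := by
    rintro _ (q | d) (p | b) (p' | c) ⟨p, rfl⟩ hpq h1 h2 h3 h4 <;> simp at h1 h2 h3 h4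
    rw [Subtype.ext (h.block_eq (fun e => hpq (congrArg _ e)) b.2 c.2 h1 h2 h3 h4)]

lemma IsSteinerTripleSystem.ncard_range_inl {v : ℕ} (h : IsSteinerTripleSystem v ℬ) :
    (Set.range (Sum.inl : P → P ⊕ ℬ)).ncard = v := by
  rw [← Set.image_univ, Set.ncard_image_of_injective _ Sum.inl_injective, Set.ncard_univ,
    h.card_points]

/-- All `2r` other points are collinear with `p`, two on each block. -/
lemma IsSteinerTripleSystem.ncard_neighborSet {r : ℕ} (h : IsSteinerTripleSystem (2 * r + 1) ℬ)
    (p : P) : ((incidenceGraph ℬ).neighborSet (.inl p)).ncard = r := by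
  have := h.finite_vertices
  have h1 := h.isPartialTripleGraph.ncard_collinearSet (p := .inl p) ⟨p, rfl⟩
  have h2 : collinearSet (incidenceGraph ℬ) (.inl p) = Set.range Sum.inl \ {.inl p} := by
    refine (h.isPartialTripleGraph.collinearSet_subset ⟨p, rfl⟩).antisymm ?_
    rintro _ ⟨⟨q, rfl⟩, hq⟩
    have hqp : q ≠ p := fun e => hq (congrArg Sum.inl e)
    obtain ⟨b, hb, h1, h2⟩ := h.exists_block hqp
    exact ⟨hq, .inr ⟨b, hb⟩, h2, h1⟩
  rw [h2, Set.ncard_sdiff_singleton_of_mem (Set.mem_range_self p), h.ncard_range_inl] at h1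
  omega

lemma IsSteinerTripleSystem.isBipartiteBiregular {m : ℕ} (hm : 2 ≤ m)
    (h : IsSteinerTripleSystem (2 * m + 1) ℬ) : IsBipartiteBiregular (incidenceGraph ℬ) 3 m 6 := by
  have := h.finite_vertices
  refine h.isPartialTripleGraph.isBipartiteBiregular hm ?_ ?_ ?_
  · rintro _ ⟨p, rfl⟩
    exact h.ncard_neighborSet p
  · rw [← Set.ncard_pos, h.ncard_range_inl]
    omega
  · rw [h.ncard_range_inl]
    omega

lemma IsSteinerTripleSystem.three_mul_card {m : ℕ} (h : IsSteinerTripleSystem (2 * m + 1) ℬ) :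
    3 * Nat.card (P ⊕ ℬ) = (m + 3) * (2 * m + 1) := by
  have := h.finite_vertices
  rw [h.isPartialTripleGraph.three_mul_card (m := m), h.ncard_range_inl]
  rintro _ ⟨p, rfl⟩
  exact h.ncard_neighborSet p

/-- The vertices left after deleting `x` and the blocks through `x`. -/
abbrev DeletedVertex (ℬ : Set (Finset P)) (x : P) : Type _ :=
  ↥(({Sum.inl x} ∪ (incidenceGraph ℬ).neighborSet (Sum.inl x))ᶜ : Set (P ⊕ ℬ))

/-- The points left after deleting `x` and the blocks through `x`. -/
def deletedPoints (ℬ : Set (Finset P)) (x : P) : Set (DeletedVertex ℬ x) :=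
  {u | u.1 ∈ Set.range Sum.inl}

/-- The blocks left after deleting `x` and the blocks through `x`. -/
def deletedBlocks (ℬ : Set (Finset P)) (x : P) : Set (DeletedVertex ℬ x) :=
  {u | u.1 ∈ Set.range Sum.inr}

lemma image_val_neighborSet_deletedIncidenceGraph (x : P) (u : DeletedVertex ℬ x) :
    Subtype.val '' (deletedIncidenceGraph ℬ x).neighborSet u =
      (incidenceGraph ℬ).neighborSet u.1 \
        ({Sum.inl x} ∪ (incidenceGraph ℬ).neighborSet (Sum.inl x)) := by
  ext w
  constructor
  · rintro ⟨w, hw, rfl⟩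
    exact ⟨hw, w.2⟩
  · rintro ⟨hw, hwx⟩
    exact ⟨⟨w, hwx⟩, hw, rfl⟩

lemma IsSteinerTripleSystem.isPartialTripleGraph_deleted {v : ℕ} (h : IsSteinerTripleSystem v ℬ)
    (x : P) : IsPartialTripleGraph (deletedIncidenceGraph ℬ x) (deletedBlocks ℬ x)
      (deletedPoints ℬ x) where
  union_eq := Set.eq_univ_of_forall fun u => by
    have := h.isPartialTripleGraph.mem_or u.1
    exact this
  bipartite := ⟨incidenceGraph_isBipartiteWith.disjoint.preimage _,
    fun u w huw => incidenceGraph_isBipartiteWith.mem_of_adj (v := u.1) (w := w.1) huw⟩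
  ncard_block := by
    rintro ⟨_, hx⟩ ⟨b, rfl⟩
    rw [← Set.ncard_image_of_injective _ Subtype.val_injective,
      image_val_neighborSet_deletedIncidenceGraph, ← h.isPartialTripleGraph.ncard_block _ ⟨b, rfl⟩]
    -- A surviving block loses no point: `x` is the only deleted point and is not on it.
    congr 1
    rw [sdiff_eq_left, Set.disjoint_left]
    rintro (p | c) hp
    · rintro (hpx | hpx)
      · obtain rfl : p = x := Sum.inl_injective hpx
        exact hx (Or.inr hp)
      · exact hpx
    · exact False.elim hp
  linear := by
    rintro p q a b hp hpq h1 h2 h3 h4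
    exact Subtype.ext (h.isPartialTripleGraph.linear hp (fun e => hpq (Subtype.ext e)) h1 h2 h3 h4)

lemma IsSteinerTripleSystem.ncard_deletedPoints {v : ℕ} (h : IsSteinerTripleSystem v ℬ) (x : P) :
    (deletedPoints ℬ x).ncard = v - 1 := by
  have := h.finite_vertices
  rw [← Set.ncard_image_of_injective _ Subtype.val_injective]
  have : Subtype.val '' deletedPoints ℬ x = Set.range Sum.inl \ {.inl x} := by
    ext w
    constructor
    · rintro ⟨u, hu, rfl⟩
      exact ⟨hu, fun e => u.2 (Or.inl e)⟩
    · rintro ⟨⟨p, rfl⟩, hp⟩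
      refine ⟨⟨.inl p, ?_⟩, ⟨p, rfl⟩, rfl⟩
      rintro (e | e)
      · exact hp e
      · exact e
  rw [this, Set.ncard_sdiff_singleton_of_mem (Set.mem_range_self x), h.ncard_range_inl]

lemma IsSteinerTripleSystem.ncard_neighborSet_deleted {r : ℕ}
    (h : IsSteinerTripleSystem (2 * r + 3) ℬ) (x : P) {u : DeletedVertex ℬ x}
    (hu : u ∈ deletedPoints ℬ x) : ((deletedIncidenceGraph ℬ x).neighborSet u).ncard = r := by
  have := h.finite_vertices
  obtain ⟨_, hx⟩ := u
  obtain ⟨p, rfl⟩ := hu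
  have hpx : p ≠ x := by
    rintro rfl
    exact hx (Or.inl rfl)
  obtain ⟨b, hb, hpb, hxb⟩ := h.exists_block hpx
  rw [← Set.ncard_image_of_injective _ Subtype.val_injective,
    image_val_neighborSet_deletedIncidenceGraph]
  -- A surviving point loses exactly one block, the one joining it to `x`.
  have hset : (incidenceGraph ℬ).neighborSet (.inl p) \
      ({Sum.inl x} ∪ (incidenceGraph ℬ).neighborSet (Sum.inl x)) =
      (incidenceGraph ℬ).neighborSet (.inl p) \ {.inr ⟨b, hb⟩} := by
    ext (q | c)
    · simp
    · simp only [Set.mem_sdiff, SimpleGraph.mem_neighborSet, incidenceGraph_adj_inl_inr,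
        Set.singleton_union, Set.mem_insert_iff, reduceCtorEq, false_or, Set.mem_singleton_iff,
        Sum.inr.injEq, and_congr_right_iff]
      intro hpc
      rw [not_iff_not]
      constructor
      · intro hxc
        exact Subtype.ext (h.block_eq hpx c.2 hb hpc hxc hpb hxb)
      · rintro rfl
        exact hxb
  have hmem : Sum.inr ⟨b, hb⟩ ∈ (incidenceGraph ℬ).neighborSet (.inl p) := hpb
  rw [hset, Set.ncard_sdiff_singleton_of_mem hmem,
    IsSteinerTripleSystem.ncard_neighborSet (r := r + 1) h]
  rfl

lemma IsSteinerTripleSystem.isBipartiteBiregular_deleted {m : ℕ} (hm : 2 ≤ m)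
    (h : IsSteinerTripleSystem (2 * m + 3) ℬ) (x : P) :
    IsBipartiteBiregular (deletedIncidenceGraph ℬ x) 3 m 6 := by
  have := h.finite_vertices
  refine (h.isPartialTripleGraph_deleted x).isBipartiteBiregular hm
    (fun u hu => h.ncard_neighborSet_deleted x hu) ?_ ?_
  · rw [← Set.ncard_pos, h.ncard_deletedPoints]
    omega
  · rw [h.ncard_deletedPoints]
    omega

lemma IsSteinerTripleSystem.three_mul_card_deleted {m : ℕ}
    (h : IsSteinerTripleSystem (2 * m + 3) ℬ) (x : P) :
    3 * Nat.card (DeletedVertex ℬ x) = (m + 3) * (2 * m + 2) := by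
  have := h.finite_vertices
  rw [(h.isPartialTripleGraph_deleted x).three_mul_card (m := m)
    fun u hu => h.ncard_neighborSet_deleted x hu, h.ncard_deletedPoints]
  rfl

end

/-! ### Recovering a triple system from a graph -/

namespace IsPartialTripleGraph

variable {V P : Type*} [Fintype P] {G : SimpleGraph V} {A B : Set V}

open Classical in
/-- The set of points of the block `a`, along a labelling `e` of the points. -/
noncomputable def blockPoints (G : SimpleGraph V) (e : B ≃ P) (a : V) : Finset P :=
  Finset.univ.filter fun i => G.Adj a (e.symm i)

lemma mem_blockPoints {e : B ≃ P} {a : V} {i : P} :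
    i ∈ blockPoints G e a ↔ G.Adj a (e.symm i) := by
  simp [blockPoints]

lemma card_blockPoints (h : IsPartialTripleGraph G A B) (e : B ≃ P) {a : V} (ha : a ∈ A) :
    (blockPoints G e a).card = 3 := by
  rw [← h.ncard_block a ha, ← Set.ncard_coe_finset,
    ← Set.ncard_image_of_injective _ (Subtype.val_injective.comp e.symm.injective)]
  congr 1
  ext p
  constructor
  · rintro ⟨i, hi, rfl⟩
    exact mem_blockPoints.1 hi
  · intro hp
    exact ⟨e ⟨p, h.mem_point ha hp⟩, mem_blockPoints.2 (by simpa using hp), by simp⟩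

/-- Two of its points already determine a block, so blocks can be identified with their point sets.
-/
lemma injOn_blockPoints (h : IsPartialTripleGraph G A B) (e : B ≃ P) :
    Set.InjOn (blockPoints G e) A := by
  intro a ha b _ hab
  obtain ⟨i, hi, j, hj, hij⟩ := Finset.one_lt_card.1
    (show 1 < (blockPoints G e a).card by rw [h.card_blockPoints e ha]; norm_num)
  have hi' := hab ▸ hi
  have hj' := hab ▸ hj
  rw [mem_blockPoints] at hi hj hi' hj'
  exact h.eq_of_adj (fun e' => hij (e.symm.injective (Subtype.ext e')))
    hi.symm hj.symm hi'.symm hj'.symm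

/-- A graph with the structure of a partial triple system is the incidence graph of its blocks. -/
lemma nonempty_iso (h : IsPartialTripleGraph G A B) (e : B ≃ P) :
    Nonempty (G ≃g incidenceGraph (blockPoints G e '' A)) := by
  let f : B ⊕ A → V := Sum.elim Subtype.val Subtype.val
  have hf : Function.Bijective f := by
    constructor
    · rintro (⟨x, hx⟩ | ⟨x, hx⟩) (⟨y, hy⟩ | ⟨y, hy⟩) (rfl : x = y)
      · rfl
      · exact absurd hx (Set.disjoint_left.1 h.bipartite.disjoint hy)
      · exact absurd hy (Set.disjoint_left.1 h.bipartite.disjoint hx)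
      · rfl
    · intro v
      rcases h.mem_or v with hv | hv
      · exact ⟨.inr ⟨v, hv⟩, rfl⟩
      · exact ⟨.inl ⟨v, hv⟩, rfl⟩
  let g : B ⊕ A ≃ P ⊕ (blockPoints G e '' A : Set (Finset P)) :=
    Equiv.sumCongr e (Equiv.Set.imageOfInjOn _ _ (h.injOn_blockPoints e))
  have hg : ∀ s t, (incidenceGraph _).Adj (g s) (g t) ↔ G.Adj (f s) (f t) := by
    have hA : ∀ {x y}, x ∈ A → y ∈ A → ¬ G.Adj x y := fun hx hy hxy =>
      Set.disjoint_left.1 h.bipartite.disjoint hy (h.mem_point hx hxy)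
    have hB : ∀ {x y}, x ∈ B → y ∈ B → ¬ G.Adj x y := fun hx hy hxy =>
      Set.disjoint_left.1 h.bipartite.disjoint (h.mem_block hx hxy) hy
    rintro (⟨x, hx⟩ | ⟨x, hx⟩) (⟨y, hy⟩ | ⟨y, hy⟩)
    · exact iff_of_false id (hB hx hy)
    · change e ⟨x, hx⟩ ∈ blockPoints G e y ↔ G.Adj x y
      simp [mem_blockPoints, G.adj_comm]
    · change e ⟨y, hy⟩ ∈ blockPoints G e x ↔ G.Adj x y
      simp [mem_blockPoints]
    · exact iff_of_false id (hA hx hy)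
  refine ⟨⟨(Equiv.ofBijective f hf).symm.trans g, ?_⟩⟩
  intro v w
  obtain ⟨s, rfl⟩ := hf.2 v
  obtain ⟨t, rfl⟩ := hf.2 w
  have hs : ∀ s, (Equiv.ofBijective f hf).symm (f s) = s := fun s =>
    (Equiv.ofBijective f hf).symm_apply_apply s
  rw [← hg]
  simp only [Equiv.trans_apply, hs]

/-- If there are as few points as the degrees allow, then the triple system is complete. -/
lemma isSteinerTripleSystem [Finite V] (h : IsPartialTripleGraph G A B) (e : B ≃ P) {m : ℕ}
    (hm : 0 < m) (hB : ∀ p ∈ B, (G.neighborSet p).ncard = m) (hcard : B.ncard = 2 * m + 1) :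
    IsSteinerTripleSystem (2 * m + 1) (blockPoints G e '' A) where
  two_le := le_rfl
  t_le_k := by norm_num
  k_le_v := by omega
  finite := inferInstance
  card_points := by rw [← hcard, ← Nat.card_congr e, Nat.card_coe_set_eq]
  card_block := by
    rintro _ ⟨a, ha, rfl⟩
    exact h.card_blockPoints e ha
  existsUnique_block := by
    classical
    intro s hs
    obtain ⟨i, j, hij, rfl⟩ := Finset.card_eq_two.1 hs
    have hp := (e.symm i).2
    -- Both sides have `2m` elements, so every other point is collinear with this one.
    have hcol : collinearSet G (e.symm i) = B \ {↑(e.symm i)} := by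
      refine Set.eq_of_subset_of_ncard_le (h.collinearSet_subset hp) ?_
      rw [h.ncard_collinearSet hp, hB _ hp, Set.ncard_sdiff_singleton_of_mem hp, hcard]
      rfl
    have hne : (e.symm i : V) ≠ e.symm j := fun e' => hij (e.symm.injective (Subtype.ext e'))
    have hj : (e.symm j : V) ∈ collinearSet G (e.symm i) := by
      rw [hcol]
      exact ⟨(e.symm j).2, hne.symm⟩
    obtain ⟨-, a, hia, haj⟩ := hj
    refine ⟨_, ⟨⟨a, h.mem_block hp hia, rfl⟩, ?_⟩, ?_⟩
    · simp [Finset.insert_subset_iff, mem_blockPoints, hia.symm, haj]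
    · rintro _ ⟨⟨b, -, rfl⟩, hsub⟩
      simp only [Finset.insert_subset_iff, Finset.singleton_subset_iff, mem_blockPoints] at hsub
      rw [h.eq_of_adj hne hia haj.symm hsub.1.symm hsub.2.symm]

end IsPartialTripleGraph

/-! ### The value of the bound, and the theorem -/

lemma mooreBoundSix_three_eq {m N : ℕ} (h : 3 * N = (m + 3) * (2 * m + 1)) :
    mooreBoundSix 3 m = N := by
  have h' : (3 : ℚ) * N = (m + 3) * (2 * m + 1) := by exact_mod_cast h
  rw [mooreBoundSix, ← Int.ceil_natCast (R := ℚ)]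
  congr 1
  push_cast
  linarith

lemma mooreBoundSix_three_of_mod_three {m : ℕ} (hm : m % 3 = 2) :
    (mooreBoundSix 3 m : ℚ) = ((m + 3) * (2 * m + 2) - (m + 1)) / 3 := by
  obtain ⟨k, rfl⟩ : ∃ k, m = 3 * k + 2 := ⟨m / 3, by omega⟩
  -- The quotient under the ceiling is `6k² + 15k + 25/3`.
  have : mooreBoundSix 3 (3 * k + 2) = 6 * k ^ 2 + 15 * k + 9 := by
    rw [mooreBoundSix, Int.ceil_eq_iff]
    push_cast
    constructor <;> linarith
  rw [this]
  push_cast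
  ring

theorem exists_isSteinerTripleSystem_of_mod_three_ne_two {m : ℕ} (hm : 0 < m) (h : m % 3 ≠ 2) :
    ∃ ℬ : Set (Finset (Fin (2 * m + 1))), IsSteinerTripleSystem (2 * m + 1) ℬ := by
  rcases (by omega : m % 3 = 0 ∨ m % 3 = 1) with h | h
  · obtain ⟨k, rfl⟩ : ∃ k, m = 3 * k := ⟨m / 3, by omega⟩
    rw [← mul_assoc]
    exact exists_isSteinerTripleSystem_six_mul_add_one (by omega)
  · obtain ⟨k, rfl⟩ : ∃ k, m = 3 * k + 1 := ⟨m / 3, by omega⟩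
    have : 2 * (3 * k + 1) + 1 = 6 * k + 3 := by ring
    rw [this]
    exact exists_isSteinerTripleSystem_six_mul_add_three k

theorem theorem3p4 (m : ℕ) (hm : 3 < m) :
    -- the case m ≡ 0, 1 (mod 3)
    ((m ≡ 0 [MOD 3] ∨ m ≡ 1 [MOD 3]) →
      (∃ ℬ : Set (Finset (Fin (2 * m + 1))), IsSteinerTripleSystem (2 * m + 1) ℬ) ∧
      (∀ (P : Type*) (ℬ : Set (Finset P)), IsSteinerTripleSystem (2 * m + 1) ℬ →
        IsBipartiteBiregularCage (incidenceGraph ℬ) 3 m 6) ∧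
      (∀ (V : Type*) (G : SimpleGraph V), IsBipartiteBiregularCage G 3 m 6 →
        (Nat.card V : ℤ) = mooreBoundSix 3 m ∧
        ∃ ℬ : Set (Finset (Fin (2 * m + 1))),
          IsSteinerTripleSystem (2 * m + 1) ℬ ∧ Nonempty (G ≃g incidenceGraph ℬ))) ∧
    -- the case m ≡ 2 (mod 3)
    (m ≡ 2 [MOD 3] →
      (∃ ℬ : Set (Finset (Fin (2 * m + 3))), IsSteinerTripleSystem (2 * m + 3) ℬ) ∧
      (∀ (P : Type*) (ℬ : Set (Finset P)) (x : P), IsSteinerTripleSystem (2 * m + 3) ℬ →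
        IsBipartiteBiregularCage (deletedIncidenceGraph ℬ x) 3 m 6) ∧
      (∀ (V : Type*) (G : SimpleGraph V), IsBipartiteBiregularCage G 3 m 6 →
        (Nat.card V : ℚ) = (mooreBoundSix 3 m : ℚ) + ((m : ℚ) + 1) / 3 ∧
        (Nat.card V : ℚ) = (((m : ℚ) + 3) * (2 * (m : ℚ) + 1)) / 3 + ((m : ℚ) + 3) / 3)) := by
  constructor
  · intro hmod
    have hmod' : m % 3 ≠ 2 := by
      simp only [Nat.ModEq] at hmod
      omega
    obtain ⟨ℬ₀, h₀⟩ := exists_isSteinerTripleSystem_of_mod_three_ne_two (by omega) hmod'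
    refine ⟨⟨ℬ₀, h₀⟩, ?_, ?_⟩
    · intro P ℬ h
      refine ⟨h.isBipartiteBiregular (by omega), fun k H hH => ?_⟩
      have h1 := hH.lower_bound
      rw [← h.three_mul_card, Nat.card_fin] at h1
      omega
    · intro V G hG
      have := hG.isBipartiteBiregular.finite
      -- An existing triple system bounds the order from above, so the lower bound is attained.
      have h1 := hG.card_le (h₀.isBipartiteBiregular (by omega))
      have h2 := hG.isBipartiteBiregular.lower_bound
      have h3 : 3 * Nat.card V = (m + 3) * (2 * m + 1) := by
        refine le_antisymm ?_ h2
        rw [← h₀.three_mul_card]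
        omega
      refine ⟨(mooreBoundSix_three_eq h3).symm, ?_⟩
      obtain ⟨A, B, hT, hB, -⟩ := hG.isBipartiteBiregular.exists_isPartialTripleGraph
      have hcard : B.ncard = 2 * m + 1 := by
        rw [hT.three_mul_card hB] at h3
        exact Nat.eq_of_mul_eq_mul_left (by omega) h3
      let e : B ≃ Fin (2 * m + 1) := Finite.equivFinOfCardEq (by rw [Nat.card_coe_set_eq, hcard])
      exact ⟨_, hT.isSteinerTripleSystem e (by omega) hB hcard, hT.nonempty_iso e⟩
  · intro hmod
    have hmod' : m % 3 = 2 := hmod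
    -- `2m + 3 = 2(m + 1) + 1` and `m + 1 ≡ 0 (mod 3)`.
    obtain ⟨ℬ₀, h₀⟩ : ∃ ℬ : Set (Finset (Fin (2 * m + 3))), IsSteinerTripleSystem (2 * m + 3) ℬ :=
      exists_isSteinerTripleSystem_of_mod_three_ne_two (m := m + 1) (by omega) (by omega)
    refine ⟨⟨ℬ₀, h₀⟩, ?_, ?_⟩
    · intro P ℬ x h
      refine ⟨h.isBipartiteBiregular_deleted (by omega) x, fun k H hH => ?_⟩
      have h1 := hH.lower_bound_of_mod_three hmod'
      rw [← h.three_mul_card_deleted x, Nat.card_fin] at h1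
      exact Nat.le_of_mul_le_mul_left h1 (by norm_num)
    · intro V G hG
      -- The deleted point 0 is an arbitrary choice.
      have h1 := hG.card_le (h₀.isBipartiteBiregular_deleted (by omega) 0)
      have h2 := hG.isBipartiteBiregular.lower_bound_of_mod_three hmod'
      have h3 : 3 * Nat.card V = (m + 3) * (2 * m + 2) := by
        refine le_antisymm ?_ h2
        rw [← h₀.three_mul_card_deleted 0]
        exact Nat.mul_le_mul_left 3 h1
      have h4 : (3 : ℚ) * Nat.card V = (m + 3) * (2 * m + 2) := by exact_mod_cast h3
      rw [mooreBoundSix_three_of_mod_three hmod']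
      constructor <;> linarith
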